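/- Let $\mathcal X$ be a Polish space with its Borel $\sigma$-field and let $\{X_t\}_{t\in\mathbb Z}$ be a stationary $\mathcal X$-valued process on a probability space with measure $P$ (its law on $\mathcal X^{\mathbb Z}$ is shift invariant). Write $X=X_0$, $X^-=(\dots,X_{-2},X_{-1})$, and let $P(dx\mid X^-)$ be the (regular) conditional distribution of $X_0$ given $X^-$. Let $\{\mathcal B_k\}$ be an increasing sequence of finite fields of subsets of $\mathcal X$, and let $[x]^k$ denote the atom of $\mathcal B_k$ that contains $x$. Let $(\ell_k)$ and $(J_k)$ be nondecreasing unbounded sequences of positive integers. Put $\tau^k_0=0$ and, for $j\ge 1$, $$\tau^k_j=\min\{t>\tau^k_{j-1}:\ ([X_{-\ell_k-t}]^k,\dots,[X_{-1-t}]^k)=([X_{-\ell_k}]^k,\dots,[X_{-1}]^k)\},$$ $$\lambda_k=\ell_k+\tau^k_{J_k},\qquad \hat P_k(dx\mid X^{-\lambda_k})=\frac1{J_k}\sum_{1\le j\le J_k}\delta_{X_{-\tau^k_j}}(dx).$$ **Theorem 1B.** In each of the cases (a) and (b) below, the times $\tau^k_j$ are almost surely all finite, and for every bounded continuous function $h:\mathcal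 X\to\mathbb R$, $$\lim_{k\to\infty}\int h(x)\,\hat P_k(dx\mid X^{-\lambda_k})=\int h(x)\,P(dx\mid X^-)\qquad\text{in }L^1(P).$$ (a) $\mathcal X=\mathbb R$, each $\mathcal B_k$ is a finite field generated by intervals, and $\bigcup_k\mathcal B_k$ generates the Borel $\sigma$-field of $\mathbb R$. (b) $\mathcal X$ is a $\sigma$-compact Polish space with a compatible metric, and the fields are constructed as follows. There are compact sets $K_1\subseteq K_2\subseteq\cdots$ with $\bigcup_kK_k=\mathcal X$, positive numbers $\varepsilon_k$ decreasing to $0$, and for each $k$ a finite collection of open balls of diameter less than $\varepsilon_k$ that covers $K_k$; $\mathcal B_0=\{\emptyset,\mathcal X\}$, and for $k\ge1$, $\mathcal B_k$ is the smallest field containing $\mathcal B_{k-1}$ and the sets $B\cap K_k$, where $B$ ranges over the balls of the cover of $K_k$. Such fields exist on every (nonempty) $\sigma$-compact Polish space with any compatible metric. -/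

import Mathlib

open MeasureTheory ProbabilityTheory Filter Topology
open scoped BoundedContinuousFunction

namespace WeakForecast

noncomputable section

/-- The atom of the finite field of sets `𝓑` that contains `x` (for a finite field, the
intersection of all its members that contain `x` is the atom); `x ↦ atom 𝓑 x` is the quantizer. -/
def atom {S : Type*} (𝓑 : Set (Set S)) (x : S) : Set S :=
  ⋂₀ {B | B ∈ 𝓑 ∧ x ∈ B}

/-- Along the path `x`, the quantized block `(x_{-ℓ-t}, …, x_{-1-t})` equals the
quantized block `(x_{-ℓ}, …, x_{-1})`. -/
def PatternRecurs {S : Type*} (𝓑 : Set (Set S)) (ℓ : ℕ) (x : ℤ → S) (t : ℕ) : Prop :=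
  ∀ i : ℕ, 1 ≤ i → i ≤ ℓ → atom 𝓑 (x (-(i : ℤ) - (t : ℤ))) = atom 𝓑 (x (-(i : ℤ)))

/-- The past recurrence times `τ_0 = 0`, `τ_j = min {t > τ_{j-1} : the pattern recurs at -t}`.
(The infimum of the empty set is `0`; hence all these times are finite exactly when
`j ↦ τ_j` is strictly increasing.) -/
def recurrenceTime {S : Type*} (𝓑 : Set (Set S)) (ℓ : ℕ) (x : ℤ → S) : ℕ → ℕ
  | 0 => 0
  | j + 1 => sInf {t : ℕ | recurrenceTime 𝓑 ℓ x j < t ∧ PatternRecurs 𝓑 ℓ x t}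

/-- The empirical distribution `(1 / J) ∑_{1 ≤ j ≤ J} δ_{x_{-τ_j}}` of the `J` samples. -/
def empiricalEstimate {S : Type*} [MeasurableSpace S] (𝓑 : Set (Set S)) (ℓ J : ℕ)
    (x : ℤ → S) : Measure S :=
  (J : ENNReal)⁻¹ •
    ∑ j ∈ Finset.Icc 1 J, Measure.dirac (x (-(recurrenceTime 𝓑 ℓ x j : ℤ)))

/-- The process `X` is stationary: its distribution on path space is shift invariant. -/
def IsStationary {Ω S : Type*} [MeasurableSpace Ω] [MeasurableSpace S] (P : Measure Ω)
    (X : ℤ → Ω → S) : Prop :=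
  P.map (fun ω (t : ℤ) => X (t + 1) ω) = P.map (fun ω (t : ℤ) => X t ω)

/-- The infinite past `X^- = (X_{-1}, X_{-2}, …)`. -/
def infinitePast {Ω S : Type*} (X : ℤ → Ω → S) (ω : Ω) : ℕ → S :=
  fun n => X (-(n : ℤ) - 1) ω

/-- The conditional distribution `P(dx | X^-)` of `X_0` given the infinite past. -/
def trueConditional {Ω S : Type*} [MeasurableSpace Ω] [MeasurableSpace S]
    [StandardBorelSpace S] [Nonempty S] (P : Measure Ω) [IsFiniteMeasure P] (X : ℤ → Ω → S)
    (ω : Ω) : Measure S :=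
  condDistrib (X 0) (infinitePast X) P (infinitePast X ω)

/-- Convergence `f k → g` in `L¹(P)`, including that all these functions belong to `L¹(P)`. -/
def TendstoInL1 {Ω : Type*} [MeasurableSpace Ω] (P : Measure Ω) (f : ℕ → Ω → ℝ)
    (g : Ω → ℝ) : Prop :=
  (∀ k, MemLp (f k) 1 P) ∧ MemLp g 1 P ∧
    Tendsto (fun k => eLpNorm (f k - g) 1 P) atTop (𝓝 0)

/-- The recurrence times are almost surely finite (so that the estimators are defined), and
`∫ h dP̂_k(· | X^{-λ_k}) → ∫ h dP(· | X^-)` in `L¹(P)` for every bounded continuous `h`. -/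
def WeaklyConsistent {Ω S : Type*} [MeasurableSpace Ω] [TopologicalSpace S]
    [MeasurableSpace S] [StandardBorelSpace S] [Nonempty S] (P : Measure Ω)
    [IsFiniteMeasure P] (X : ℤ → Ω → S) (𝓑 : ℕ → Set (Set S)) (ℓ J : ℕ → ℕ) : Prop :=
  (∀ᵐ ω ∂P, ∀ k, StrictMono (recurrenceTime (𝓑 k) (ℓ k) (fun t => X t ω))) ∧
  ∀ h : S →ᵇ ℝ,
    TendstoInL1 P
      (fun k ω => ∫ x, h x ∂(empiricalEstimate (𝓑 k) (ℓ k) (J k) (fun t => X t ω)))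
      (fun ω => ∫ x, h x ∂(trueConditional P X ω))

/-- An increasing sequence of finite fields of subsets of the line, each generated by
intervals (bounded or not, possibly degenerate), which together generate the Borel `σ`-field. -/
structure IsIntervalFields (𝓑 : ℕ → Set (Set ℝ)) : Prop where
  mono : Monotone 𝓑
  isSetAlgebra : ∀ k, IsSetAlgebra (𝓑 k)
  finite : ∀ k, (𝓑 k).Finite
  generated_by_intervals : ∀ k, ∃ 𝓘 : Set (Set ℝ),
    (∀ I ∈ 𝓘, I.OrdConnected) ∧ 𝓑 k = generateSetAlgebra 𝓘
  generate_borel : MeasurableSpace.generateFrom (⋃ k, 𝓑 k) = borel ℝ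

/-- Fields built from compact sets `K k` increasing to the whole space and finite covers of
`K k` by open balls of diameter less than `ε k`, where `ε k` decreases to `0`: the field `𝓑 0`
is trivial, and `𝓑 (k + 1)` is the smallest field containing `𝓑 k` and the traces on
`K (k + 1)` of the balls in its cover. A ball is listed in `C k` by its centre and radius. -/
def IsBallFields {S : Type*} [MetricSpace S] (𝓑 : ℕ → Set (Set S)) : Prop :=
  ∃ (K : ℕ → Set S) (ε : ℕ → ℝ) (C : ℕ → Finset (S × ℝ)),
    Monotone K ∧ (∀ k, IsCompact (K k)) ∧ (⋃ k, K k) = Set.univ ∧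
    Antitone ε ∧ (∀ k, 0 < ε k) ∧ Tendsto ε atTop (𝓝 0) ∧
    (∀ k, ∀ p ∈ C k, 0 < p.2 ∧ Metric.diam (Metric.ball p.1 p.2) < ε k) ∧
    (∀ k, K k ⊆ ⋃ p ∈ C k, Metric.ball p.1 p.2) ∧
    𝓑 0 = {∅, Set.univ} ∧
    ∀ k, 𝓑 (k + 1) = generateSetAlgebra
      (𝓑 k ∪ {B | ∃ p ∈ C (k + 1), B = Metric.ball p.1 p.2 ∩ K (k + 1)})

end

end WeakForecast

/-! On path space let T be the shift towards the past, and let R send a path to its first T-iterate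
with the same quantized block. The k-th estimate is then the average of `h` at coordinate 0 over R
x, ..., R^J x. Since T is invertible and preserves the law, so does R
(`measurePreserving_inducedMap`).

Let φ be the conditional mean of h(x_0) given the strict past, and D = h(x_0) - φ. The return time
depends only on the past and is at least 1, so D∘R^j with j ≥ 1 is past-measurable, hence orthogonal
to D. By invariance the D∘R^j are pairwise orthogonal, and their average is O(1/√J) in L²
(`eLpNorm_average_le`).

It remains to compare the average of φ∘R^j with φ. The conditional mean of φ given the quantized
block is constant along R-orbits, and by Lévy's upward theorem it tends to φ in L¹, because the
blocks eventually generate the past. The fields enter only through being finite, increasing and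
generating; `h` need only be bounded and measurable. -/

namespace WeakForecast

noncomputable section

/-! ### Recurrence and the first-return map on the fibres of a countable partition. -/

section InducedMap

variable {α β : Type*}

theorem measurable_sInf_nat [MeasurableSpace α] {A : α → Set ℕ}
    (hA : ∀ n, MeasurableSet {x | n ∈ A x}) : Measurable fun x => sInf (A x) := by
  have hle : ∀ n, MeasurableSet {x | sInf (A x) ≤ n} := by
    intro n
    -- Since `sInf ∅ = 0`, points with `A x` empty belong to every sublevel set.
    have : {x | sInf (A x) ≤ n} = (⋃ i ∈ Set.Iic n, {x | i ∈ A x}) ∪ ⋂ i, {x | i ∈ A x}ᶜ := by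
      ext x
      simp only [Set.mem_ofPred_eq, Set.mem_union, Set.mem_iUnion, Set.mem_Iic, Set.mem_iInter,
        Set.mem_compl_iff, exists_prop]
      constructor
      · intro h
        by_cases hne : (A x).Nonempty
        · exact Or.inl ⟨_, h, Nat.sInf_mem hne⟩
        · exact Or.inr fun i hi => hne ⟨i, hi⟩
      · rintro (⟨i, hi, hx⟩ | h)
        · exact (Nat.sInf_le hx).trans hi
        · have : A x = ∅ := Set.eq_empty_of_forall_notMem h
          simp [this]
    rw [this]
    exact (MeasurableSet.biUnion (Set.to_countable _) fun i _ => hA i).union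
      (MeasurableSet.iInter fun i => (hA i).compl)
  exact measurable_of_Iic hle

/-- The first time `n ≥ 1` at which the orbit of `x` returns to the `π`-fibre of `x`. -/
def firstReturn (T : α → α) (π : α → β) (x : α) : ℕ :=
  sInf {n | π (T^[n + 1] x) = π x} + 1

/-- The map induced by `T` simultaneously on all the fibres of `π`. -/
def inducedMap (T : α → α) (π : α → β) (x : α) : α :=
  T^[firstReturn T π x] x

/-- The orbit of `x` returns infinitely often to the `π`-fibre of `x`. -/
def IsRecurrent (T : α → α) (π : α → β) (x : α) : Prop :=
  ∃ᶠ n in atTop, π (T^[n] x) = π x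

theorem IsRecurrent.nonempty {T : α → α} {π : α → β} {x : α} (hx : IsRecurrent T π x) :
    {n | π (T^[n + 1] x) = π x}.Nonempty := by
  obtain ⟨n, hn, h⟩ := frequently_atTop.1 hx 1
  refine ⟨n - 1, ?_⟩
  rwa [Set.mem_ofPred_eq, Nat.sub_add_cancel hn]

theorem IsRecurrent.apply_inducedMap {T : α → α} {π : α → β} {x : α} (hx : IsRecurrent T π x) :
    π (inducedMap T π x) = π x :=
  Nat.sInf_mem hx.nonempty

theorem IsRecurrent.iterate {T : α → α} {π : α → β} {x : α} (hx : IsRecurrent T π x) {n : ℕ}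
    (hn : π (T^[n] x) = π x) : IsRecurrent T π (T^[n] x) := by
  refine frequently_atTop.2 fun a => ?_
  obtain ⟨m, hm, h⟩ := frequently_atTop.1 hx (a + n)
  refine ⟨m - n, by omega, ?_⟩
  rw [← Function.iterate_add_apply, Nat.sub_add_cancel (by omega), hn, h]

theorem firstReturn_ne {T : α → α} {π : α → β} {x : α} {n : ℕ} (hn : 0 < n)
    (h : n < firstReturn T π x) : π (T^[n] x) ≠ π x := by
  intro h'
  have : n - 1 ∈ {n | π (T^[n + 1] x) = π x} := by
    rwa [Set.mem_ofPred_eq, Nat.sub_add_cancel hn]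
  have := Nat.sInf_le this
  unfold firstReturn at h
  omega

theorem measurable_firstReturn [MeasurableSpace α] [MeasurableSpace β] [Countable β]
    [MeasurableSingletonClass β] {T : α → α} {π : α → β}
    (h : ∀ n, Measurable fun x => π (T^[n] x)) : Measurable (firstReturn T π) :=
  (measurable_sInf_nat fun n => measurableSet_eq_fun (h (n + 1)) (h 0)).add_const 1

/-- Split by the value of the return time, which is never 0. Two σ-fields are allowed because the
past and the past-with-present are needed later as `m` and `m'`. -/
theorem measurable_inducedMap (m' : MeasurableSpace α) [m : MeasurableSpace α] [MeasurableSpace β]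
    [Countable β] [MeasurableSingletonClass β] {T : α → α} {π : α → β}
    (h : ∀ n, Measurable fun x => π (T^[n] x)) (hT : ∀ n, Measurable[m, m'] T^[n + 1]) :
    Measurable[m, m'] (inducedMap T π) := by
  intro s hs
  have : inducedMap T π ⁻¹' s = ⋃ n : ℕ, firstReturn T π ⁻¹' {n + 1} ∩ T^[n + 1] ⁻¹' s := by
    ext x
    simp only [inducedMap, Set.mem_preimage, Set.mem_iUnion, Set.mem_inter_iff,
      Set.mem_singleton_iff]
    constructor
    · intro hx
      exact ⟨sInf {n | π (T^[n + 1] x) = π x}, rfl, hx⟩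
    · rintro ⟨n, hn, hx⟩
      rwa [hn]
  rw [this]
  exact MeasurableSet.iUnion fun n =>
    (measurable_firstReturn h (measurableSet_singleton _)).inter (hT n hs)

/-- Poincaré recurrence, applied to each of the countably many fibres. -/
theorem ae_isRecurrent [MeasurableSpace α] [MeasurableSpace β] [Countable β]
    [MeasurableSingletonClass β] {μ : Measure α} [IsFiniteMeasure μ] {T : α → α} {π : α → β}
    (hT : MeasurePreserving T μ μ) (hπ : Measurable π) : ∀ᵐ x ∂μ, IsRecurrent T π x := by
  have : ∀ᵐ x ∂μ, ∀ b, x ∈ π ⁻¹' {b} → ∃ᶠ n in atTop, T^[n] x ∈ π ⁻¹' {b} :=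
    ae_all_iff.2 fun b => hT.conservative.ae_mem_imp_frequently_image_mem
      (hπ (measurableSet_singleton b)).nullMeasurableSet
  filter_upwards [this] with x hx
  exact hx (π x) rfl

/-- Sort the points of `B` by the time n after which the induced map lands on them: `E n` holds
those reached from their n-th predecessor by a first return. The `E n` are disjoint, since a point
reached from predecessors n < m would give the m-th one an earlier return at time m - n. Invariance
of T then bounds the measure of the preimage of `B` by that of `B`, and equal total masses turn the
inequality into equality. -/
theorem measurePreserving_inducedMap [MeasurableSpace α] [MeasurableSpace β] [Countable β]
    [MeasurableSingletonClass β] {μ : Measure α} [IsFiniteMeasure μ] {T U : α → α} {π : α → β}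
    (hT : MeasurePreserving T μ μ) (hU : Measurable U) (hUT : Function.LeftInverse U T)
    (hTU : Function.LeftInverse T U) (hπ : Measurable π) :
    MeasurePreserving (inducedMap T π) μ μ := by
  have hπT : ∀ n, Measurable fun x => π (T^[n] x) := fun n =>
    hπ.comp (hT.measurable.iterate n)
  have hS : Measurable (inducedMap T π) :=
    measurable_inducedMap _ hπT fun n => hT.measurable.iterate (n + 1)
  have hR := measurable_firstReturn hπT
  refine ⟨hS, Measure.eq_of_le_of_measure_univ_eq ?_ ?_⟩
  swap
  · rw [Measure.map_apply hS MeasurableSet.univ, Set.preimage_univ]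
  refine Measure.le_iff.2 fun B hB => ?_
  rw [Measure.map_apply hS hB]
  set A : ℕ → Set α := fun n => firstReturn T π ⁻¹' {n} ∩ {x | π (T^[n] x) = π x} with hA
  have hAm : ∀ n, MeasurableSet (A n) := fun n =>
    (hR (measurableSet_singleton n)).inter (measurableSet_eq_fun (hπT n) hπ)
  set E : ℕ → Set α := fun n => U^[n] ⁻¹' A n ∩ B with hE
  have hEm : ∀ n, MeasurableSet (E n) := fun n => ((hU.iterate n) (hAm n)).inter hB
  have hdisj : ∀ n m, n < m → Disjoint (E n) (E m) := by
    intro n m hnm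
    refine Set.disjoint_left.2 fun y hy hy' => ?_
    obtain ⟨⟨hn1, hn2⟩, -⟩ := hy
    obtain ⟨⟨hm1, hm2⟩, -⟩ := hy'
    simp only [Set.mem_preimage, Set.mem_singleton_iff, Set.mem_ofPred_eq] at hn1 hn2 hm1 hm2
    rw [(hTU.iterate n) y] at hn2
    rw [(hTU.iterate m) y] at hm2
    have hn0 : 0 < n := by rw [← hn1]; exact Nat.succ_pos _
    refine firstReturn_ne (T := T) (π := π) (x := U^[m] y) (n := m - n) (by omega) (by omega) ?_
    have : T^[m - n] (U^[m] y) = U^[n] y := by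
      conv_lhs => rw [show m = (m - n) + n by omega, Function.iterate_add_apply]
      rw [show m - n + n - n = m - n by omega, (hTU.iterate (m - n)) _]
    rw [this, ← hn2, hm2]
  calc μ (inducedMap T π ⁻¹' B) ≤ μ (⋃ n, T^[n] ⁻¹' E n) := by
        refine measure_mono_ae ?_
        filter_upwards [ae_isRecurrent hT hπ] with x hx hxB
        refine Set.mem_iUnion.2 ⟨firstReturn T π x, ?_, hxB⟩
        rw [Set.mem_preimage, (hUT.iterate _) x]
        exact ⟨rfl, hx.apply_inducedMap⟩
    _ ≤ ∑' n, μ (T^[n] ⁻¹' E n) := measure_iUnion_le _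
    _ = ∑' n, μ (E n) := by
        congr 1 with n
        exact (hT.iterate n).measure_preimage (hEm n).nullMeasurableSet
    _ = μ (⋃ n, E n) := by
        refine (measure_iUnion (fun n m hnm => ?_) hEm).symm
        rcases lt_or_gt_of_ne hnm with h | h
        · exact hdisj n m h
        · exact (hdisj m n h).symm
    _ ≤ μ B := measure_mono (Set.iUnion_subset fun n => Set.inter_subset_right)

end InducedMap

/-! ### Averages along orbits: orthogonality and contraction in L¹. -/

section Averages

variable {α : Type*} {m m' mα : MeasurableSpace α} {μ : Measure α}

theorem integral_mul_eq_zero_of_condExp_eq_zero [IsFiniteMeasure μ] (hm : m ≤ mα)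
    {D G : α → ℝ} (hD : Integrable D μ) (hD0 : μ[D | m] =ᵐ[μ] 0)
    (hG : StronglyMeasurable[m] G) (hDG : Integrable (D * G) μ) :
    ∫ x, D x * G x ∂μ = 0 := by
  have h := condExp_mul_of_stronglyMeasurable_right hG hDG hD
  have : μ[D * G | m] =ᵐ[μ] 0 := by
    filter_upwards [h, hD0] with x hx hx0
    simp [hx, hx0]
  calc ∫ x, D x * G x ∂μ = ∫ x, (μ[D * G | m]) x ∂μ := (integral_condExp hm).symm
    _ = 0 := by rw [integral_congr_ae this]; simp

/-- The averages along an orbit of a function that is orthogonal to the functions of the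
strict past, where the transformation maps into the strict past. -/
theorem eLpNorm_average_le [IsProbabilityMeasure μ] (hm : m ≤ m') (hm' : m' ≤ mα)
    {S : α → α} (hS : MeasurePreserving S μ μ)
    (hSm : Measurable[m, m'] S) {D : α → ℝ} (hDm : StronglyMeasurable[m'] D) {C : ℝ}
    (hDC : ∀ x, |D x| ≤ C) (hD0 : μ[D | m] =ᵐ[μ] 0) {J : ℕ} (hJ : 1 ≤ J) :
    eLpNorm (fun x => (J : ℝ)⁻¹ * ∑ j ∈ Finset.Icc 1 J, D (S^[j] x)) 1 μ
      ≤ ENNReal.ofReal (C / √J) := by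
  have hC : 0 ≤ C := by
    obtain ⟨x⟩ : Nonempty α := Measure.nonempty_of_neZero μ
    exact (abs_nonneg _).trans (hDC x)
  have hDmeas : Measurable D := (hDm.mono hm').measurable
  have hDS : ∀ j, Measurable fun x => D (S^[j] x) := fun j =>
    hDmeas.comp (hS.measurable.iterate j)
  have hDSb : ∀ j x, ‖D (S^[j] x)‖ ≤ C := fun j x => hDC _
  have hint1 : ∀ j, Integrable (fun x => D (S^[j] x)) μ := fun j =>
    Integrable.of_bound (hDS j).aestronglyMeasurable C (ae_of_all _ (hDSb j))
  have hbound : ∀ i j x, ‖D (S^[i] x) * D (S^[j] x)‖ ≤ C * C := fun i j x => by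
    rw [norm_mul]
    exact mul_le_mul (hDSb i x) (hDSb j x) (norm_nonneg _) hC
  have hint2 : ∀ i j, Integrable (fun x => D (S^[i] x) * D (S^[j] x)) μ := fun i j =>
    Integrable.of_bound ((hDS i).mul (hDS j)).aestronglyMeasurable (C * C)
      (ae_of_all _ (hbound i j))
  have hSpow : ∀ n, Measurable[m, m'] S^[n + 1] := by
    intro n
    induction n with
    | zero => simpa using hSm
    | succ n ih =>
      rw [Function.iterate_succ']
      exact hSm.comp (ih.mono le_rfl hm)
  -- Invariance under `S^[i]` reduces to i = 0, where the later factor is `m`-measurable.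
  have horth : ∀ i n, ∫ x, D (S^[i] x) * D (S^[i + (n + 1)] x) ∂μ = 0 := by
    intro i n
    have h1 : ∫ x, D x * D (S^[n + 1] x) ∂μ = 0 :=
      integral_mul_eq_zero_of_condExp_eq_zero (hm.trans hm') (hint1 0) hD0
        (hDm.comp_measurable (hSpow n)) (hint2 0 (n + 1))
    have h2 := (hS.iterate i).map_eq
    rw [← h2, integral_map (hS.iterate i).measurable.aemeasurable
      (by rw [h2]; exact (hint2 0 (n + 1)).aestronglyMeasurable)] at h1
    rw [← h1]
    refine integral_congr_ae (ae_of_all _ fun x => ?_)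
    simp only [add_comm i, Function.iterate_add_apply S (n + 1) i]
  have horth' : ∀ i j, i ≠ j → ∫ x, D (S^[i] x) * D (S^[j] x) ∂μ = 0 := by
    intro i j hij
    rcases lt_or_gt_of_ne hij with h | h
    · have := horth i (j - i - 1)
      rwa [show i + (j - i - 1 + 1) = j by omega] at this
    · have := horth j (i - j - 1)
      rw [show j + (i - j - 1 + 1) = i by omega] at this
      simpa only [mul_comm] using this
  set F : α → ℝ := fun x => ∑ j ∈ Finset.Icc 1 J, D (S^[j] x) with hF
  have hFm : Measurable F := Finset.measurable_fun_sum _ fun j _ => hDS j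
  have hFsq : ∀ x, F x ^ 2 = ∑ i ∈ Finset.Icc 1 J, ∑ j ∈ Finset.Icc 1 J,
      D (S^[i] x) * D (S^[j] x) := fun x => by rw [sq, hF, Finset.sum_mul_sum]
  have hFint : Integrable (fun x => F x ^ 2) μ := by
    simp_rw [hFsq]
    exact integrable_finsetSum _ fun i _ => integrable_finsetSum _ fun j _ => hint2 i j
  have hsq : ∫ x, F x ^ 2 ∂μ ≤ J * C ^ 2 := by
    simp_rw [hFsq]
    rw [integral_finsetSum _ fun i _ => integrable_finsetSum _ fun j _ => hint2 i j]
    have : ∀ i ∈ Finset.Icc 1 J, ∫ x, ∑ j ∈ Finset.Icc 1 J, D (S^[i] x) * D (S^[j] x) ∂μ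
        ≤ C ^ 2 := by
      intro i hi
      rw [integral_finsetSum _ fun j _ => hint2 i j,
        Finset.sum_eq_single_of_mem i hi fun j _ hj => horth' i j hj.symm]
      calc ∫ x, D (S^[i] x) * D (S^[i] x) ∂μ ≤ ∫ _, C * C ∂μ :=
            integral_mono (hint2 i i) (integrable_const _)
              fun x => (le_abs_self _).trans (hbound i i x)
        _ = C ^ 2 := by simp [sq]
    calc _ ≤ ∑ i ∈ Finset.Icc 1 J, C ^ 2 := Finset.sum_le_sum this
      _ = J * C ^ 2 := by simp
  have hJ0 : (0 : ℝ) < J := by exact_mod_cast hJ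
  have hFi : Integrable F μ := integrable_finsetSum _ fun j _ => hint1 j
  have hFabs : ∫ x, |F x| ∂μ ≤ C * √J := by
    refine le_of_sq_le_sq ?_ (by positivity)
    -- Nonnegativity of the variance of |F| passes from the L² bound to L¹.
    have h1 : (∫ x, |F x| ∂μ) ^ 2 ≤ ∫ x, |F x| ^ 2 ∂μ := by
      have := variance_nonneg (fun x => |F x|) μ
      rw [variance_eq_sub ((memLp_two_iff_integrable_sq hFm.abs.aestronglyMeasurable).2
        (by simpa using hFint))] at this
      simpa using this
    simp only [sq_abs] at h1
    rw [mul_pow, Real.sq_sqrt hJ0.le]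
    linarith
  rw [eLpNorm_one_eq_lintegral_enorm, ← ofReal_integral_norm_eq_lintegral_enorm
    (hFi.const_mul _)]
  refine ENNReal.ofReal_le_ofReal ?_
  calc ∫ x, ‖(J : ℝ)⁻¹ * F x‖ ∂μ = (J : ℝ)⁻¹ * ∫ x, |F x| ∂μ := by
        rw [← integral_const_mul]
        congr 1 with x
        rw [norm_mul, Real.norm_eq_abs, Real.norm_eq_abs, abs_of_pos (inv_pos.2 hJ0)]
    _ ≤ (J : ℝ)⁻¹ * (C * √J) := by gcongr
    _ = C / √J := by
        have := Real.sqrt_pos.2 hJ0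
        field_simp
        rw [Real.sq_sqrt hJ0.le, mul_comm]

theorem eLpNorm_average_comp_iterate_le {S : α → α} (hS : MeasurePreserving S μ μ) {f : α → ℝ}
    (hf : AEStronglyMeasurable f μ) {J : ℕ} (hJ : 1 ≤ J) :
    eLpNorm (fun x => (J : ℝ)⁻¹ * ∑ j ∈ Finset.Icc 1 J, f (S^[j] x)) 1 μ ≤ eLpNorm f 1 μ := by
  have h1 : (fun x => (J : ℝ)⁻¹ * ∑ j ∈ Finset.Icc 1 J, f (S^[j] x))
      = (J : ℝ)⁻¹ • ∑ j ∈ Finset.Icc 1 J, f ∘ S^[j] := by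
    ext x; simp
  have hJ0 : (J : ENNReal) ≠ 0 := by simp; omega
  rw [h1, eLpNorm_const_smul]
  calc _ ≤ ‖(J : ℝ)⁻¹‖ₑ * ∑ j ∈ Finset.Icc 1 J, eLpNorm (f ∘ S^[j]) 1 μ := by
        gcongr
        exact eLpNorm_sum_le (fun j _ => hf.comp_measurePreserving (hS.iterate j)) le_rfl
    _ = (J : ENNReal)⁻¹ * (J * eLpNorm f 1 μ) := by
        simp_rw [fun j => eLpNorm_comp_measurePreserving (p := 1) hf (hS.iterate j)]
        rw [enorm_inv (by positivity), Real.enorm_natCast]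
        simp
    _ = eLpNorm f 1 μ := by
        rw [← mul_assoc, ENNReal.inv_mul_cancel hJ0 (ENNReal.natCast_ne_top J), one_mul]

end Averages

/-! ### Recurrence times as iterates of the induced shift. -/

section PathSpace

variable {S : Type*}

/-- The shift of two-sided sequences that moves the past to the origin. -/
def pathShift (x : ℤ → S) : ℤ → S := fun t => x (t - 1)

theorem pathShift_iterate (n : ℕ) (x : ℤ → S) (t : ℤ) : pathShift^[n] x t = x (t - n) := by
  induction n generalizing x t with
  | zero => simp
  | succ n ih =>
    rw [Function.iterate_succ_apply, ih, pathShift]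
    push_cast
    congr 1
    ring

/-- The quantized block `(x_{-ℓ}, …, x_{-1})`, recorded by membership in the sets of `𝓑`. -/
def pattern (𝓑 : Set (Set S)) (ℓ : ℕ) (x : ℤ → S) : Fin ℓ → 𝓑 → Prop :=
  fun i B => x (-(i : ℤ) - 1) ∈ B.1

/-- Allows atoms to be replaced by membership vectors, which take finitely many values when `𝓑` is
finite and are easily seen to be measurable. -/
theorem atom_eq_atom_iff {𝓑 : Set (Set S)} {s s' : S} :
    atom 𝓑 s = atom 𝓑 s' ↔ ∀ B ∈ 𝓑, s ∈ B ↔ s' ∈ B := by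
  have key : ∀ {s s' : S}, atom 𝓑 s = atom 𝓑 s' → ∀ B ∈ 𝓑, s ∈ B → s' ∈ B := by
    intro s s' h B hB hs
    have : s' ∈ atom 𝓑 s := h ▸ Set.mem_sInter.2 fun B hB => hB.2
    exact Set.mem_sInter.1 this B ⟨hB, hs⟩
  refine ⟨fun h B hB => ⟨key h B hB, key h.symm B hB⟩, fun h => ?_⟩
  unfold atom
  congr 1
  ext B
  exact and_congr_right fun hB => h B hB

theorem patternRecurs_iff {𝓑 : Set (Set S)} {ℓ : ℕ} {x : ℤ → S} {t : ℕ} :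
    PatternRecurs 𝓑 ℓ x t ↔ pattern 𝓑 ℓ (pathShift^[t] x) = pattern 𝓑 ℓ x := by
  simp only [PatternRecurs, atom_eq_atom_iff, funext_iff, pattern, pathShift_iterate, eq_iff_iff]
  constructor
  · intro h i B
    have := h (i + 1) (by omega) (by omega) B.1 B.2
    push_cast at this
    rwa [neg_add'] at this
  · intro h i hi hi' B hB
    have := h ⟨i - 1, by omega⟩ ⟨B, hB⟩
    simp only at this
    rwa [show -((i - 1 : ℕ) : ℤ) - 1 = -(i : ℤ) by omega] at this

theorem recurrenceTime_spec {𝓑 : Set (Set S)} {ℓ : ℕ} {x : ℤ → S}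
    (hx : IsRecurrent pathShift (pattern 𝓑 ℓ) x) (j : ℕ) :
    pathShift^[recurrenceTime 𝓑 ℓ x j] x = (inducedMap pathShift (pattern 𝓑 ℓ))^[j] x ∧
      pattern 𝓑 ℓ (pathShift^[recurrenceTime 𝓑 ℓ x j] x) = pattern 𝓑 ℓ x ∧
      recurrenceTime 𝓑 ℓ x j < recurrenceTime 𝓑 ℓ x (j + 1) := by
  -- Matching the original block is the same as matching the block at the current sample, so the gap
  -- to the next time is a first return. Recurrence makes the infimum one over a nonempty set,
  -- excluding the default value 0.
  have hstep : ∀ j, pattern 𝓑 ℓ (pathShift^[recurrenceTime 𝓑 ℓ x j] x) = pattern 𝓑 ℓ x →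
      recurrenceTime 𝓑 ℓ x (j + 1) = firstReturn pathShift (pattern 𝓑 ℓ)
        (pathShift^[recurrenceTime 𝓑 ℓ x j] x) + recurrenceTime 𝓑 ℓ x j := by
    intro j hj
    have hmem := Nat.sInf_mem (hx.iterate hj).nonempty
    simp only [Set.mem_ofPred_eq, ← Function.iterate_add_apply, hj] at hmem
    rw [recurrenceTime, firstReturn]
    simp only [← Function.iterate_add_apply, hj]
    refine le_antisymm (Nat.sInf_le ⟨by omega, patternRecurs_iff.2 hmem⟩) ?_
    refine le_csInf ⟨_, by omega, patternRecurs_iff.2 hmem⟩ ?_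
    rintro t ⟨ht, ht'⟩
    have : t - recurrenceTime 𝓑 ℓ x j - 1 ∈ {n | pattern 𝓑 ℓ
        (pathShift^[n + 1 + recurrenceTime 𝓑 ℓ x j] x) = pattern 𝓑 ℓ x} := by
      rw [Set.mem_ofPred_eq, show t - recurrenceTime 𝓑 ℓ x j - 1 + 1
        + recurrenceTime 𝓑 ℓ x j = t by omega]
      exact patternRecurs_iff.1 ht'
    have := Nat.sInf_le this
    omega
  have hlt : ∀ j, pattern 𝓑 ℓ (pathShift^[recurrenceTime 𝓑 ℓ x j] x) = pattern 𝓑 ℓ x →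
      recurrenceTime 𝓑 ℓ x j < recurrenceTime 𝓑 ℓ x (j + 1) := by
    intro j hj
    rw [hstep j hj, firstReturn]
    omega
  induction j with
  | zero => exact ⟨rfl, rfl, hlt 0 rfl⟩
  | succ j ih =>
    obtain ⟨h1, h2, -⟩ := ih
    have h3 : pathShift^[recurrenceTime 𝓑 ℓ x (j + 1)] x
        = inducedMap pathShift (pattern 𝓑 ℓ) (pathShift^[recurrenceTime 𝓑 ℓ x j] x) := by
      rw [hstep j h2, Function.iterate_add_apply, inducedMap]
    have h4 : pattern 𝓑 ℓ (pathShift^[recurrenceTime 𝓑 ℓ x (j + 1)] x) = pattern 𝓑 ℓ x := by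
      rw [h3, (hx.iterate h2).apply_inducedMap, h2]
    exact ⟨by rw [h3, h1, Function.iterate_succ_apply'], h4, hlt _ h4⟩

theorem pattern_inducedMap_iterate {𝓑 : Set (Set S)} {ℓ : ℕ} {x : ℤ → S}
    (hx : IsRecurrent pathShift (pattern 𝓑 ℓ) x) (j : ℕ) :
    pattern 𝓑 ℓ ((inducedMap pathShift (pattern 𝓑 ℓ))^[j] x) = pattern 𝓑 ℓ x := by
  obtain ⟨h1, h2, -⟩ := recurrenceTime_spec hx j
  rw [← h1, h2]

theorem strictMono_recurrenceTime {𝓑 : Set (Set S)} {ℓ : ℕ} {x : ℤ → S}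
    (hx : IsRecurrent pathShift (pattern 𝓑 ℓ) x) : StrictMono (recurrenceTime 𝓑 ℓ x) :=
  strictMono_nat_of_lt_succ fun j => (recurrenceTime_spec hx j).2.2

theorem integral_empiricalEstimate [MeasurableSpace S] {𝓑 : Set (Set S)} {ℓ : ℕ}
    (J : ℕ) {x : ℤ → S} (hx : IsRecurrent pathShift (pattern 𝓑 ℓ) x) {h : S → ℝ}
    (hh : Measurable h) :
    ∫ s, h s ∂(empiricalEstimate 𝓑 ℓ J x) = (J : ℝ)⁻¹ * ∑ j ∈ Finset.Icc 1 J,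
      h ((inducedMap pathShift (pattern 𝓑 ℓ))^[j] x 0) := by
  rw [empiricalEstimate, integral_smul_measure, integral_finsetSum_measure
    fun j _ => integrable_dirac' hh.stronglyMeasurable (by simp)]
  simp only [ENNReal.toReal_inv, ENNReal.toReal_natCast, smul_eq_mul]
  congr 1
  refine Finset.sum_congr rfl fun j _ => ?_
  rw [integral_dirac' _ _ hh.stronglyMeasurable, ← (recurrenceTime_spec hx j).1,
    pathShift_iterate, zero_sub]

end PathSpace

/-! ### The past, the present and the filtration of quantized blocks. -/

section Sigma

variable {S : Type*} [MeasurableSpace S]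

/-- The strict past `(x_{-1}, x_{-2}, …)` of a path. -/
def pathPast (x : ℤ → S) : ℕ → S := fun n => x (-(n : ℤ) - 1)

/-- The `σ`-field of the strict past. -/
abbrev pastSigma (S : Type*) [MeasurableSpace S] : MeasurableSpace (ℤ → S) :=
  MeasurableSpace.comap pathPast MeasurableSpace.pi

/-- The `σ`-field of the past and the present. -/
abbrev presentSigma (S : Type*) [MeasurableSpace S] : MeasurableSpace (ℤ → S) :=
  MeasurableSpace.comap (fun x (n : ℕ) => x (-(n : ℤ))) MeasurableSpace.pi

theorem measurable_pathPast : Measurable (pathPast : (ℤ → S) → ℕ → S) :=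
  measurable_pi_iff.2 fun _ => measurable_pi_apply _

theorem pastSigma_measurable_eval (n : ℕ) :
    Measurable[pastSigma S] fun x : ℤ → S => x (-(n : ℤ) - 1) :=
  (measurable_pi_apply n).comp (comap_measurable pathPast)

theorem presentSigma_measurable_eval (n : ℕ) :
    Measurable[presentSigma S] fun x : ℤ → S => x (-(n : ℤ)) :=
  (measurable_pi_apply n).comp (comap_measurable fun (x : ℤ → S) (n : ℕ) => x (-(n : ℤ)))

theorem presentSigma_le : presentSigma S ≤ MeasurableSpace.pi :=
  measurable_iff_comap_le.1 (measurable_pi_iff.2 fun _ => measurable_pi_apply _)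

theorem pastSigma_le_presentSigma : pastSigma S ≤ presentSigma S := by
  refine measurable_iff_comap_le.1 (@measurable_pi_iff _ _ _ (presentSigma S) _ _ |>.2 fun n => ?_)
  have := presentSigma_measurable_eval (S := S) (n + 1)
  push_cast at this
  simp only [neg_add'] at this
  exact this

theorem pastSigma_le : pastSigma S ≤ MeasurableSpace.pi :=
  pastSigma_le_presentSigma.trans presentSigma_le

theorem measurable_pathShift_iterate (n : ℕ) : Measurable (pathShift^[n] : (ℤ → S) → ℤ → S) :=
  measurable_pi_iff.2 fun t => by
    simp only [pathShift_iterate]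
    exact measurable_pi_apply _

theorem measurable_pathShift_past (n : ℕ) :
    Measurable[pastSigma S, presentSigma S] (pathShift^[n + 1] : (ℤ → S) → ℤ → S) := by
  refine measurable_comap_iff.2 (@measurable_pi_iff _ _ _ (pastSigma S) _ _ |>.2 fun i => ?_)
  simp only [Function.comp_def, pathShift_iterate]
  have := pastSigma_measurable_eval (S := S) (i + n)
  push_cast at this
  push_cast
  convert this using 3
  ring

theorem measurable_pattern_past {𝓑 : Set (Set S)} (h𝓑 : ∀ B ∈ 𝓑, MeasurableSet B) (ℓ : ℕ) :
    Measurable[pastSigma S] (pattern 𝓑 ℓ) := by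
  refine @measurable_pi_iff _ _ _ (pastSigma S) _ _ |>.2 fun i =>
    @measurable_pi_iff _ _ _ (pastSigma S) _ _ |>.2 fun B => ?_
  exact (measurable_mem.2 (h𝓑 B.1 B.2)).comp (pastSigma_measurable_eval i)

theorem measurable_pattern_shift_past {𝓑 : Set (Set S)} (h𝓑 : ∀ B ∈ 𝓑, MeasurableSet B) (ℓ n : ℕ) :
    Measurable[pastSigma S] fun x => pattern 𝓑 ℓ (pathShift^[n] x) := by
  cases n with
  | zero => exact measurable_pattern_past h𝓑 ℓ
  | succ n =>
    exact (measurable_pattern_past h𝓑 ℓ).comp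
      ((measurable_pathShift_past n).mono le_rfl pastSigma_le_presentSigma)

/-- The filtration generated by the quantized blocks. -/
def patternFiltration {𝓑 : ℕ → Set (Set S)} (h𝓑 : ∀ k, ∀ B ∈ 𝓑 k, MeasurableSet B)
    (hmono : Monotone 𝓑) {ℓ : ℕ → ℕ} (hℓ : Monotone ℓ) :
    Filtration ℕ (MeasurableSpace.pi : MeasurableSpace (ℤ → S)) where
  seq k := MeasurableSpace.comap (pattern (𝓑 k) (ℓ k)) MeasurableSpace.pi
  mono' := by
    intro k k' hk
    refine measurable_iff_comap_le.1 ?_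
    have : pattern (𝓑 k) (ℓ k) = (fun (p : Fin (ℓ k') → 𝓑 k' → Prop) (i : Fin (ℓ k)) (B : 𝓑 k) =>
        p (Fin.castLE (hℓ hk) i) ⟨B.1, hmono hk B.2⟩) ∘ pattern (𝓑 k') (ℓ k') := rfl
    rw [this]
    refine Measurable.comp ?_ (comap_measurable _)
    fun_prop
  le' k := (measurable_iff_comap_le.1 (measurable_pattern_past (h𝓑 k) (ℓ k))).trans pastSigma_le

/-- The event x_{-n-1} ∈ B with B in `𝓑 k` is read off any block at a level k' ≥ k with `ℓ k' > n`;
such B generate. -/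
theorem pastSigma_le_iSup_patternFiltration {𝓑 : ℕ → Set (Set S)}
    (h𝓑 : ∀ k, ∀ B ∈ 𝓑 k, MeasurableSet B) (hmono : Monotone 𝓑) {ℓ : ℕ → ℕ} (hℓ : Monotone ℓ)
    (hℓ' : Tendsto ℓ atTop atTop)
    (hgen : MeasurableSpace.generateFrom (⋃ k, 𝓑 k) = ‹MeasurableSpace S›) :
    pastSigma S ≤ ⨆ k, patternFiltration h𝓑 hmono hℓ k := by
  refine measurable_iff_comap_le.1 (@measurable_pi_iff _ _ _
    (⨆ k, patternFiltration h𝓑 hmono hℓ k) _ _ |>.2 fun n => ?_)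
  have : ∀ B ∈ ⋃ k, 𝓑 k, MeasurableSet[⨆ k, patternFiltration h𝓑 hmono hℓ k]
      ((fun x : ℤ → S => pathPast x n) ⁻¹' B) := by
    intro B hB
    obtain ⟨k, hk⟩ := Set.mem_iUnion.1 hB
    obtain ⟨k', hkk', hk'⟩ := ((hℓ'.eventually_gt_atTop n).and (eventually_ge_atTop k)).exists
    refine le_iSup (fun k => (patternFiltration h𝓑 hmono hℓ k : MeasurableSpace (ℤ → S))) k' _ ?_
    have hm : Measurable fun p : Fin (ℓ k') → 𝓑 k' → Prop => p ⟨n, hkk'⟩ ⟨B, hmono hk' hk⟩ := by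
      fun_prop
    exact ⟨_, measurableSet_setOfPred.2 hm, rfl⟩
  have h2 := @measurable_generateFrom _ _ (⨆ k, patternFiltration h𝓑 hmono hℓ k) _ _ this
  rwa [hgen] at h2

end Sigma

/-! ### L¹ convergence on path space and its transfer to the process. -/

section Convergence

variable {S : Type*} [MeasurableSpace S]

theorem measurePreserving_pathShift {μ : Measure (ℤ → S)}
    (hμ : μ.map (fun x t => x (t + 1)) = μ) : MeasurePreserving pathShift μ μ := by
  have hm : Measurable (pathShift : (ℤ → S) → ℤ → S) := measurable_pathShift_iterate 1
  have hm' : Measurable fun (x : ℤ → S) (t : ℤ) => x (t + 1) :=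
    measurable_pi_iff.2 fun _ => measurable_pi_apply _
  refine ⟨hm, ?_⟩
  conv_lhs => rw [← hμ]
  rw [Measure.map_map hm hm']
  convert Measure.map_id
  ext x t
  simp [pathShift]

theorem measurePreserving_inducedMap_pattern {μ : Measure (ℤ → S)} [IsFiniteMeasure μ]
    (hμ : MeasurePreserving pathShift μ μ) {𝓑 : Set (Set S)} (hfin : 𝓑.Finite)
    (h𝓑 : ∀ B ∈ 𝓑, MeasurableSet B) (ℓ : ℕ) :
    MeasurePreserving (inducedMap pathShift (pattern 𝓑 ℓ)) μ μ := by
  have := hfin.to_subtype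
  refine measurePreserving_inducedMap (U := fun x t => x (t + 1)) hμ
    (measurable_pi_iff.2 fun _ => measurable_pi_apply _) (fun x => ?_) (fun x => ?_)
    ((measurable_pattern_past h𝓑 ℓ).mono pastSigma_le le_rfl)
  all_goals ext t; simp [pathShift]

theorem ae_isRecurrent_pattern {μ : Measure (ℤ → S)} [IsFiniteMeasure μ]
    (hμ : MeasurePreserving pathShift μ μ) {𝓑 : Set (Set S)} (hfin : 𝓑.Finite)
    (h𝓑 : ∀ B ∈ 𝓑, MeasurableSet B) (ℓ : ℕ) :
    ∀ᵐ x ∂μ, IsRecurrent pathShift (pattern 𝓑 ℓ) x := by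
  have := hfin.to_subtype
  exact ae_isRecurrent hμ ((measurable_pattern_past h𝓑 ℓ).mono pastSigma_le le_rfl)

theorem tendsto_eLpNorm_average [StandardBorelSpace S] [Nonempty S] {μ : Measure (ℤ → S)}
    [IsProbabilityMeasure μ] (hμ : MeasurePreserving pathShift μ μ) {𝓑 : ℕ → Set (Set S)}
    (hmono : Monotone 𝓑) (hfin : ∀ k, (𝓑 k).Finite)
    (hgen : MeasurableSpace.generateFrom (⋃ k, 𝓑 k) = ‹MeasurableSpace S›)
    {ℓ J : ℕ → ℕ} (hℓ_mono : Monotone ℓ) (hℓ : Tendsto ℓ atTop atTop) (hJ_pos : ∀ k, 1 ≤ J k)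
    (hJ : Tendsto J atTop atTop) {h : S → ℝ} (hh : Measurable h) {C : ℝ} (hC : ∀ s, |h s| ≤ C) :
    Tendsto (fun k => eLpNorm ((fun x => (J k : ℝ)⁻¹ * ∑ j ∈ Finset.Icc 1 (J k),
        h ((inducedMap pathShift (pattern (𝓑 k) (ℓ k)))^[j] x 0)) -
        fun x => ∫ s, h s ∂(condDistrib (fun x : ℤ → S => x 0) pathPast μ (pathPast x))) 1 μ)
      atTop (𝓝 0) := by
  have h𝓑 : ∀ k, ∀ B ∈ 𝓑 k, MeasurableSet B := fun k B hB => by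
    rw [← hgen]
    exact MeasurableSpace.measurableSet_generateFrom (Set.mem_iUnion.2 ⟨k, hB⟩)
  set φ : (ℤ → S) → ℝ :=
    fun x => ∫ s, h s ∂(condDistrib (fun x : ℤ → S => x 0) pathPast μ (pathPast x)) with hφ
  set R : ℕ → (ℤ → S) → (ℤ → S) := fun k => inducedMap pathShift (pattern (𝓑 k) (ℓ k)) with hR
  have hRμ : ∀ k, MeasurePreserving (R k) μ μ := fun k =>
    measurePreserving_inducedMap_pattern hμ (hfin k) (h𝓑 k) (ℓ k)
  have hC0 : 0 ≤ C := (abs_nonneg _).trans (hC (Classical.arbitrary S))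
  have hφm : StronglyMeasurable[pastSigma S] φ :=
    stronglyMeasurable_integral_condDistrib (hh.comp measurable_snd).stronglyMeasurable
  have hφm' : StronglyMeasurable φ := hφm.mono pastSigma_le
  have hφC : ∀ x, |φ x| ≤ C := fun x => by
    simpa using norm_integral_le_of_norm_le_const (f := h)
      (μ := condDistrib (fun x : ℤ → S => x 0) pathPast μ (pathPast x)) (ae_of_all _ hC)
  have hφi : Integrable φ μ :=
    Integrable.of_bound hφm'.aestronglyMeasurable C (ae_of_all _ hφC)
  have hhm : Measurable fun x : ℤ → S => h (x 0) := hh.comp (measurable_pi_apply 0)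
  have hhi : Integrable (fun x : ℤ → S => h (x 0)) μ :=
    Integrable.of_bound hhm.aestronglyMeasurable C (ae_of_all _ fun x => hC _)
  have hcond : μ[fun x : ℤ → S => h (x 0) | pastSigma S] =ᵐ[μ] φ :=
    condExp_ae_eq_integral_condDistrib measurable_pathPast
      (measurable_pi_apply 0).aemeasurable hh.stronglyMeasurable hhi
  set D : (ℤ → S) → ℝ := (fun x => h (x 0)) - φ with hD
  have hDm : StronglyMeasurable[presentSigma S] D := by
    refine StronglyMeasurable.sub (Measurable.stronglyMeasurable ?_)
      (hφm.mono pastSigma_le_presentSigma)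
    have := hh.comp (presentSigma_measurable_eval (S := S) 0)
    simp only [Nat.cast_zero, neg_zero] at this
    exact this
  have hDC : ∀ x, |D x| ≤ C + C := fun x =>
    (abs_sub _ _).trans (add_le_add (hC _) (hφC x))
  have hD0 : μ[D | pastSigma S] =ᵐ[μ] 0 := by
    filter_upwards [condExp_sub hhi hφi (pastSigma S), hcond] with x hx hx'
    rw [hx, Pi.sub_apply, hx', condExp_of_stronglyMeasurable pastSigma_le hφm hφi]
    simp
  set ℱ := patternFiltration h𝓑 hmono hℓ_mono with hℱ
  have hlevy : Tendsto (fun k => eLpNorm (μ[φ | ℱ k] - φ) 1 μ) atTop (𝓝 0) :=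
    hφi.tendsto_eLpNorm_condExp
      (hφm.mono (pastSigma_le_iSup_patternFiltration h𝓑 hmono hℓ_mono hℓ hgen))
  -- A function measurable for the σ-field of the block factors through the block, which R preserves
  -- at recurrent points.
  have hinv : ∀ k, ∀ᵐ x ∂μ, ∀ j, (μ[φ | ℱ k]) ((R k)^[j] x) = (μ[φ | ℱ k]) x := by
    intro k
    filter_upwards [ae_isRecurrent_pattern hμ (hfin k) (h𝓑 k) (ℓ k)] with x hx j
    exact (stronglyMeasurable_condExp (m := ℱ k)).factorsThrough (pattern_inducedMap_iterate hx j)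
  have hcm : ∀ k, AEStronglyMeasurable (μ[φ | ℱ k]) μ := fun k =>
    integrable_condExp.aestronglyMeasurable
  have hbound : ∀ k, eLpNorm ((fun x => (J k : ℝ)⁻¹ * ∑ j ∈ Finset.Icc 1 (J k),
      h ((R k)^[j] x 0)) - φ) 1 μ ≤ ENNReal.ofReal ((C + C) / √(J k)) +
        eLpNorm (μ[φ | ℱ k] - φ) 1 μ + eLpNorm (μ[φ | ℱ k] - φ) 1 μ := by
    intro k
    have := (hfin k).to_subtype
    set f₁ : (ℤ → S) → ℝ := fun x => (J k : ℝ)⁻¹ * ∑ j ∈ Finset.Icc 1 (J k), D ((R k)^[j] x)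
    set f₂ : (ℤ → S) → ℝ := fun x => (J k : ℝ)⁻¹ * ∑ j ∈ Finset.Icc 1 (J k),
      (φ - μ[φ | ℱ k]) ((R k)^[j] x)
    have havg : ∀ g : (ℤ → S) → ℝ, AEStronglyMeasurable g μ → AEStronglyMeasurable
        (fun x => (J k : ℝ)⁻¹ * ∑ j ∈ Finset.Icc 1 (J k), g ((R k)^[j] x)) μ := fun g hg =>
      (Finset.aestronglyMeasurable_fun_sum _ fun j _ =>
        hg.comp_measurePreserving ((hRμ k).iterate j)).const_mul _
    have hf₁ : AEStronglyMeasurable f₁ μ :=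
      havg D (hDm.mono presentSigma_le).aestronglyMeasurable
    have hf₂ : AEStronglyMeasurable f₂ μ :=
      havg _ (hφm'.aestronglyMeasurable.sub (hcm k))
    have hJ0 : (J k : ℝ) ≠ 0 := by exact_mod_cast Nat.one_le_iff_ne_zero.1 (hJ_pos k)
    -- Orthogonal part, averaged Lévy error, and Lévy error at the path itself; invariance of the
    -- conditional mean lets it be inserted in the average.
    have hdecomp : ((fun x => (J k : ℝ)⁻¹ * ∑ j ∈ Finset.Icc 1 (J k), h ((R k)^[j] x 0)) - φ)
        =ᵐ[μ] (f₁ + f₂ + (μ[φ | ℱ k] - φ)) := by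
      filter_upwards [hinv k] with x hx
      simp only [f₁, f₂, hD, Pi.sub_apply, Pi.add_apply, hx, Finset.sum_sub_distrib,
        Finset.sum_const, Nat.card_Icc, add_tsub_cancel_right, nsmul_eq_mul]
      field_simp
      ring
    rw [eLpNorm_congr_ae hdecomp]
    refine (eLpNorm_add_le (hf₁.add hf₂) ((hcm k).sub hφm'.aestronglyMeasurable) le_rfl).trans ?_
    gcongr
    refine (eLpNorm_add_le hf₁ hf₂ le_rfl).trans ?_
    gcongr
    · exact eLpNorm_average_le pastSigma_le_presentSigma presentSigma_le (hRμ k)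
        (measurable_inducedMap (m := pastSigma S) _ (measurable_pattern_shift_past (h𝓑 k) (ℓ k))
          measurable_pathShift_past) hDm hDC hD0 (hJ_pos k)
    · rw [eLpNorm_sub_comm (μ[φ | ℱ k])]
      exact eLpNorm_average_comp_iterate_le (hRμ k)
        (hφm'.aestronglyMeasurable.sub (hcm k)) (hJ_pos k)
  refine tendsto_of_tendsto_of_tendsto_of_le_of_le tendsto_const_nhds ?_ (fun _ => bot_le) hbound
  have h1 : Tendsto (fun k => ENNReal.ofReal ((C + C) / √(J k))) atTop (𝓝 0) := by
    rw [← ENNReal.ofReal_zero]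
    exact ENNReal.tendsto_ofReal (tendsto_const_nhds.div_atTop
      (Real.tendsto_sqrt_atTop.comp (tendsto_natCast_atTop_atTop.comp hJ)))
  simpa using (h1.add hlevy).add hlevy

theorem weaklyConsistent_of_generateFrom {Ω : Type*} [MeasurableSpace Ω] {P : Measure Ω}
    [IsProbabilityMeasure P] [TopologicalSpace S] [OpensMeasurableSpace S] [StandardBorelSpace S]
    [Nonempty S] {X : ℤ → Ω → S} (hX : ∀ t, Measurable (X t)) (hstat : IsStationary P X)
    {𝓑 : ℕ → Set (Set S)} (hmono : Monotone 𝓑) (hfin : ∀ k, (𝓑 k).Finite)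
    (hgen : MeasurableSpace.generateFrom (⋃ k, 𝓑 k) = ‹MeasurableSpace S›)
    {ℓ J : ℕ → ℕ} (hℓ_mono : Monotone ℓ) (hℓ : Tendsto ℓ atTop atTop) (hJ_pos : ∀ k, 1 ≤ J k)
    (hJ : Tendsto J atTop atTop) : WeaklyConsistent P X 𝓑 ℓ J := by
  have h𝓑 : ∀ k, ∀ B ∈ 𝓑 k, MeasurableSet B := fun k B hB => by
    rw [← hgen]
    exact MeasurableSpace.measurableSet_generateFrom (Set.mem_iUnion.2 ⟨k, hB⟩)
  have hpath : Measurable fun ω (t : ℤ) => X t ω := measurable_pi_iff.2 hX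
  set μ := P.map fun ω (t : ℤ) => X t ω with hμdef
  have hmp : MeasurePreserving (fun ω (t : ℤ) => X t ω) P μ := ⟨hpath, rfl⟩
  have : IsProbabilityMeasure μ := Measure.isProbabilityMeasure_map hpath.aemeasurable
  have hμ : MeasurePreserving pathShift μ μ := by
    refine measurePreserving_pathShift ?_
    rw [hμdef, Measure.map_map (measurable_pi_iff.2 fun _ => measurable_pi_apply _) hpath]
    exact hstat
  -- The conditional kernel depends only on the joint law of past and present.
  have hcd : condDistrib (X 0) (infinitePast X) P
      = condDistrib (fun x : ℤ → S => x 0) pathPast μ := by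
    rw [condDistrib, condDistrib]
    congr 1
    rw [hμdef, Measure.map_map (measurable_pathPast.prodMk (measurable_pi_apply 0)) hpath]
    rfl
  have hrec : ∀ᵐ ω ∂P, ∀ k, IsRecurrent pathShift (pattern (𝓑 k) (ℓ k)) fun t => X t ω :=
    ae_all_iff.2 fun k =>
      hmp.quasiMeasurePreserving.ae (ae_isRecurrent_pattern hμ (hfin k) (h𝓑 k) (ℓ k))
  refine ⟨hrec.mono fun ω hω k => strictMono_recurrenceTime (hω k), fun h => ?_⟩
  have hh : Measurable h := h.continuous.measurable
  have hC : ∀ s, |h s| ≤ ‖h‖ := h.norm_coe_le_norm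
  set F : ℕ → (ℤ → S) → ℝ := fun k x => (J k : ℝ)⁻¹ * ∑ j ∈ Finset.Icc 1 (J k),
    h ((inducedMap pathShift (pattern (𝓑 k) (ℓ k)))^[j] x 0) with hF
  set φ : (ℤ → S) → ℝ :=
    fun x => ∫ s, h s ∂(condDistrib (fun x : ℤ → S => x 0) pathPast μ (pathPast x)) with hφ
  have hFm : ∀ k, Measurable (F k) := fun k =>
    (Finset.measurable_fun_sum _ fun j _ => hh.comp ((measurable_pi_apply 0).comp
      ((measurePreserving_inducedMap_pattern hμ (hfin k) (h𝓑 k) (ℓ k)).iterate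
        j).measurable)).const_mul _
  have hFC : ∀ k x, ‖F k x‖ ≤ ‖h‖ := fun k x => by
    have hJ0 : (0 : ℝ) < J k := by exact_mod_cast hJ_pos k
    rw [norm_mul, Real.norm_of_nonneg (inv_nonneg.2 hJ0.le), inv_mul_le_iff₀ hJ0]
    refine (norm_sum_le_of_le _ fun j _ => hC _).trans ?_
    simp
  have hφm : StronglyMeasurable φ :=
    (stronglyMeasurable_integral_condDistrib
      (hh.comp measurable_snd).stronglyMeasurable).mono pastSigma_le
  have hφC : ∀ x, ‖φ x‖ ≤ ‖h‖ := fun x => by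
    simpa using norm_integral_le_of_norm_le_const (f := h)
      (μ := condDistrib (fun x : ℤ → S => x 0) pathPast μ (pathPast x)) (ae_of_all _ hC)
  have hest : ∀ k, (fun ω => ∫ x, h x ∂(empiricalEstimate (𝓑 k) (ℓ k) (J k) fun t => X t ω))
      =ᵐ[P] F k ∘ fun ω (t : ℤ) => X t ω := fun k => by
    filter_upwards [hrec] with ω hω
    exact integral_empiricalEstimate (J k) (hω k) hh
  have htrue : (fun ω => ∫ x, h x ∂(trueConditional P X ω)) = φ ∘ fun ω (t : ℤ) => X t ω := by
    ext ω
    rw [trueConditional, hcd]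
    rfl
  refine ⟨fun k => ?_, ?_, ?_⟩
  · refine (memLp_congr_ae (hest k)).2 (MemLp.comp_measurePreserving ?_ hmp)
    exact MemLp.of_bound (hFm k).aestronglyMeasurable ‖h‖ (ae_of_all _ (hFC k))
  · rw [htrue]
    exact (MemLp.of_bound hφm.aestronglyMeasurable ‖h‖ (ae_of_all _ hφC)).comp_measurePreserving hmp
  · refine (tendsto_eLpNorm_average hμ hmono hfin hgen hℓ_mono hℓ hJ_pos hJ hh hC).congr fun k => ?_
    rw [htrue, eLpNorm_congr_ae ((hest k).sub EventuallyEq.rfl)]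
    exact (eLpNorm_comp_measurePreserving
      ((hFm k).aestronglyMeasurable.sub hφm.aestronglyMeasurable) hmp).symm

end Convergence

/-! ### Ball fields: existence, finiteness and generation of the Borel σ-field. -/

section BallFields

/-- Preimages under the membership map into the finite set `𝒜 → Prop` form a finite algebra
containing `𝒜`. -/
theorem finite_generateSetAlgebra {α : Type*} {𝒜 : Set (Set α)} (h : 𝒜.Finite) :
    (generateSetAlgebra 𝒜).Finite := by
  have := h.to_subtype
  let v : α → 𝒜 → Prop := fun x A => x ∈ A.1
  refine (Set.finite_range fun C : Set (𝒜 → Prop) => v ⁻¹' C).subset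
    (IsSetAlgebra.generateSetAlgebra_subset (fun A hA => ⟨{p | p ⟨A, hA⟩}, rfl⟩) ?_)
  refine ⟨⟨∅, rfl⟩, ?_, ?_⟩
  · rintro _ ⟨C, rfl⟩
    exact ⟨Cᶜ, rfl⟩
  · rintro _ _ ⟨C, rfl⟩ ⟨C', rfl⟩
    exact ⟨C ∪ C', rfl⟩

variable {S : Type*} [MetricSpace S]

theorem exists_isBallFields [SigmaCompactSpace S] : ∃ 𝓑 : ℕ → Set (Set S), IsBallFields 𝓑 := by
  have hcover : ∀ k : ℕ, ∃ C : Finset (S × ℝ),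
      (∀ p ∈ C, 0 < p.2 ∧ Metric.diam (Metric.ball p.1 p.2) < 1 / ((k : ℝ) + 1)) ∧
      compactCovering S k ⊆ ⋃ p ∈ C, Metric.ball p.1 p.2 := by
    intro k
    have hk : (0 : ℝ) < 1 / ((k : ℝ) + 1) := Nat.one_div_pos_of_nat
    -- A third, so that the diameter, at most 2r, is strictly below the bound.
    set r : ℝ := 1 / ((k : ℝ) + 1) / 3 with hr
    have hr0 : 0 < r := by positivity
    obtain ⟨t, ht, htc⟩ := Metric.totallyBounded_iff.1
      (isCompact_compactCovering S k).totallyBounded r hr0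
    refine ⟨ht.toFinset.map ⟨fun y => (y, r), fun a b hab => (Prod.ext_iff.1 hab).1⟩, ?_, ?_⟩
    · simp only [Finset.mem_map, Set.Finite.mem_toFinset]
      rintro _ ⟨y, -, rfl⟩
      refine ⟨hr0, (Metric.diam_ball hr0.le).trans_lt ?_⟩
      simp only [hr]
      linarith
    · intro x hx
      obtain ⟨y, hy, hxy⟩ := Set.mem_iUnion₂.1 (htc hx)
      exact Set.mem_iUnion₂.2 ⟨(y, r),
        Finset.mem_map.2 ⟨y, ht.mem_toFinset.2 hy, rfl⟩, hxy⟩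
  choose C hC hCK using hcover
  refine ⟨Nat.rec {∅, Set.univ} fun k 𝓑 => generateSetAlgebra
      (𝓑 ∪ {B | ∃ p ∈ C (k + 1), B = Metric.ball p.1 p.2 ∩ compactCovering S (k + 1)}),
    compactCovering S, fun k => 1 / ((k : ℝ) + 1), C, fun _ _ h => compactCovering_subset S h,
    isCompact_compactCovering S, iUnion_compactCovering S,
    fun _ _ h => Nat.one_div_le_one_div h, fun _ => Nat.one_div_pos_of_nat,
    tendsto_one_div_add_atTop_nhds_zero_nat, hC, hCK, rfl, fun _ => rfl⟩

variable {𝓑 : ℕ → Set (Set S)}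

theorem IsBallFields.monotone (h : IsBallFields 𝓑) : Monotone 𝓑 := by
  obtain ⟨K, ε, C, -, -, -, -, -, -, -, -, -, hsucc⟩ := h
  refine monotone_nat_of_le_succ fun k => ?_
  rw [hsucc]
  exact Set.subset_union_left.trans self_subset_generateSetAlgebra

theorem IsBallFields.finite (h : IsBallFields 𝓑) (k : ℕ) : (𝓑 k).Finite := by
  obtain ⟨K, ε, C, -, -, -, -, -, -, -, -, hzero, hsucc⟩ := h
  induction k with
  | zero => rw [hzero]; exact Set.toFinite _
  | succ k ih =>
    rw [hsucc]
    refine finite_generateSetAlgebra (ih.union ?_)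
    refine ((C (k + 1)).finite_toSet.image
      fun p => Metric.ball p.1 p.2 ∩ K (k + 1)).subset ?_
    rintro _ ⟨p, hp, rfl⟩
    exact ⟨p, hp, rfl⟩

theorem IsBallFields.measurableSet [MeasurableSpace S] [BorelSpace S] (h : IsBallFields 𝓑) (k : ℕ) :
    ∀ B ∈ 𝓑 k, MeasurableSet B := by
  obtain ⟨K, ε, C, -, hK, -, -, -, -, -, -, hzero, hsucc⟩ := h
  induction k with
  | zero => rw [hzero]; rintro B (rfl | rfl) <;> simp
  | succ k ih =>
    rw [hsucc]
    refine IsSetAlgebra.generateSetAlgebra_subset (ℬ := {B | MeasurableSet B}) ?_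
      ⟨MeasurableSet.empty, fun _ => MeasurableSet.compl, fun _ _ => MeasurableSet.union⟩
    rintro B (hB | ⟨p, -, rfl⟩)
    · exact ih B hB
    · exact Metric.isOpen_ball.measurableSet.inter (hK _).measurableSet

/-- Every open set is the union of the members of the fields it contains, and there are only
countably many members: around each point, a trace of a small enough ball fits inside. -/
theorem IsBallFields.generateFrom_eq [MeasurableSpace S] [BorelSpace S] (h : IsBallFields 𝓑) :
    MeasurableSpace.generateFrom (⋃ k, 𝓑 k) = ‹MeasurableSpace S› := by
  refine le_antisymm (MeasurableSpace.generateFrom_le fun B hB => ?_) ?_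
  · obtain ⟨k, hk⟩ := Set.mem_iUnion.1 hB
    exact h.measurableSet k B hk
  have hcount : (⋃ k, 𝓑 k).Countable := Set.countable_iUnion fun k => (h.finite k).countable
  obtain ⟨K, ε, C, hKmono, -, hKuniv, -, -, hε, hC, hcov, -, hsucc⟩ := h
  rw [BorelSpace.measurable_eq (α := S), borel]
  refine MeasurableSpace.generateFrom_le fun U hU => ?_
  have hUeq : U = ⋃₀ {B | B ∈ ⋃ k, 𝓑 k ∧ B ⊆ U} := by
    refine subset_antisymm (fun x hx => ?_) (Set.sUnion_subset fun B hB => hB.2)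
    obtain ⟨δ, hδ, hδU⟩ := Metric.isOpen_iff.1 hU x hx
    obtain ⟨k₀, hk₀⟩ := Set.mem_iUnion.1 (hKuniv ▸ Set.mem_univ x)
    -- The index is shifted because ball traces are only adjoined from level 1 on.
    obtain ⟨k, hkε, hk⟩ := ((tendsto_add_atTop_iff_nat 1).2 hε |>.eventually_lt_const hδ |>.and
      (eventually_ge_atTop k₀)).exists
    obtain ⟨p, hp, hxp⟩ := Set.mem_iUnion₂.1 (hcov (k + 1) (hKmono (hk.trans k.le_succ) hk₀))
    refine Set.mem_sUnion.2 ⟨Metric.ball p.1 p.2 ∩ K (k + 1), ⟨Set.mem_iUnion.2 ⟨k + 1, ?_⟩, ?_⟩,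
      hxp, hKmono (hk.trans k.le_succ) hk₀⟩
    · rw [hsucc]
      exact self_subset_generateSetAlgebra (Or.inr ⟨p, hp, rfl⟩)
    · rintro y ⟨hy, -⟩
      exact hδU (((Metric.dist_le_diam_of_mem Metric.isBounded_ball hy hxp).trans_lt
        (hC _ p hp).2).trans hkε)
  rw [hUeq]
  exact MeasurableSet.sUnion (hcount.mono fun B hB => hB.1) fun B hB =>
    MeasurableSpace.measurableSet_generateFrom hB.1

end BallFields

end

end WeakForecast

theorem mainTheorem2 {Ω : Type*} [MeasurableSpace Ω] (P : Measure Ω) [IsProbabilityMeasure P]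
    (ℓ J : ℕ → ℕ) (hℓ_pos : ∀ k, 1 ≤ ℓ k) (hJ_pos : ∀ k, 1 ≤ J k)
    (hℓ_mono : Monotone ℓ) (hJ_mono : Monotone J)
    (hℓ : Tendsto ℓ atTop atTop) (hJ : Tendsto J atTop atTop) :
    (∀ (X : ℤ → Ω → ℝ), (∀ t, Measurable (X t)) → WeakForecast.IsStationary P X →
      ∀ 𝓑 : ℕ → Set (Set ℝ), WeakForecast.IsIntervalFields 𝓑 →
        WeakForecast.WeaklyConsistent P X 𝓑 ℓ J) ∧
    (∀ (S : Type*) [MetricSpace S] [PolishSpace S] [SigmaCompactSpace S] [Nonempty S]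
      [MeasurableSpace S] [BorelSpace S],
      (∃ 𝓑 : ℕ → Set (Set S), WeakForecast.IsBallFields 𝓑) ∧
      ∀ (X : ℤ → Ω → S), (∀ t, Measurable (X t)) → WeakForecast.IsStationary P X →
        ∀ 𝓑 : ℕ → Set (Set S), WeakForecast.IsBallFields 𝓑 →
          WeakForecast.WeaklyConsistent P X 𝓑 ℓ J) := by
  refine ⟨fun X hX hstat 𝓑 h𝓑 => ?_, fun S _ _ _ _ _ _ =>
    ⟨WeakForecast.exists_isBallFields, fun X hX hstat 𝓑 h𝓑 => ?_⟩⟩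
  · exact WeakForecast.weaklyConsistent_of_generateFrom hX hstat h𝓑.mono h𝓑.finite
      (h𝓑.generate_borel.trans (BorelSpace.measurable_eq (α := ℝ)).symm) hℓ_mono hℓ hJ_pos hJ
  · exact WeakForecast.weaklyConsistent_of_generateFrom hX hstat h𝓑.monotone h𝓑.finite
      h𝓑.generateFrom_eq hℓ_mono hℓ hJ_pos hJ
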